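/- **Theorem (belief-state lifting yields an equivalent fully observed process).** Let $(S,A,O,P,G,r,\gamma,\nu_0)$ be a discounted POMDP: $S,A,O$ are standard Borel spaces, $P(ds'\mid s,a)$ is a Markov kernel from $S\times A$ to $S$ (transition), $G(do\mid s',a)$ is a Markov kernel from $S\times A$ to $O$ (observation after action $a$ has led to $s'$), $r:S\times A\to\mathbb R$ is bounded and measurable, $\gamma\in(0,1)$, and $\nu_0$ belongs to $B:=\Delta(S)$, the space of probability measures on $S$ with the $\sigma$-algebra generated by the evaluations $b\mapsto b(U)$. Let $\tau:B\times A\times O\to B$ be a measurable Bayes update: for all $b\in B$, $a\in A$, the map $o\mapsto\tau(b,a,o)$ is a version of the conditional law of $s'$ given $o$ when $(s,s',o)$ has the law $b(ds)P(ds'\mid s,a)G(do\mid s',a)$. A randomized history-dependent policy is a sequence $\pi=(\pi_t)_{t\ge0}$ of Markov kernels, where $\pi_t$ gives the law of the action $a_t$ as a function of the history $h_t=(a_0,o_1,\dots,a_{t-1},o_t)$. Under $\pi$ one has $s_0\sim\nu_0$, $a_t\sim\pi_t(\cdot\mid h_t)$, $s_{t+1}\sim P(\cdot\mid s_t,a_t)$,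 $o_{t+1}\sim G(\cdot\mid s_{t+1},a_t)$, and $$V^\pi_{\mathrm{POMDP}}(\nu_0):=\mathbb E_\pi\Big[\sum_{t\ge0}\gamma^t r(s_t,a_t)\Big].$$ The beliefs along a history are $b_0=\nu_0$, $b_{t+1}=\tau(b_t,a_t,o_{t+1})$. The belief MDP is $\mathcal M_B=(B,A,P_B,r_B,\gamma)$, where $P_B(\cdot\mid b,a)$ is the image under $o\mapsto\tau(b,a,o)$ of the predictive law $\ell(E\mid b,a)=\int_S\int_S G(E\mid s',a)\,P(ds'\mid s,a)\,b(ds)$, and $r_B(b,a)=\int_S r(s,a)\,b(ds)$. A randomized nonstationary belief policy is a sequence $\pi_B=(\pi_{B,t})_{t\ge0}$ of Markov kernels from $B$ to $A$; it generates the process $b^B_0=b$, $a^B_t\sim\pi_{B,t}(\cdot\mid b^B_t)$, $b^B_{t+1}\sim P_B(\cdot\mid b^B_t,a^B_t)$, and $V^{\pi_B}_{\mathcal M_B}(b):=\mathbb E\big[\sum_{t\ge0}\gamma^t r_B(b^B_t,a^B_t)\big]$. Then: 1. For every $t$, $b_t$ is a measurable function of $h_t$, and under every history-dependent policy it is a version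 of the conditional law of $s_t$ given $h_t$. 2. For every history-dependent policy $\pi$ there is a nonstationary belief policy $\pi_B$ such that, with $b^B_0=\nu_0$, the pairs $(b_t,a_t)$ and $(b^B_t,a^B_t)$ have the same law for every $t$, and $V^\pi_{\mathrm{POMDP}}(\nu_0)=V^{\pi_B}_{\mathcal M_B}(\nu_0)$. 3. Conversely, for every nonstationary belief policy $\pi_B$, the history-dependent policy $\pi_t(\cdot\mid h_t):=\pi_{B,t}(\cdot\mid b_t)$ satisfies the same two conclusions. 4. The returns in both classes are bounded above, and $$\sup_\pi V^\pi_{\mathrm{POMDP}}(\nu_0)=\sup_{\pi_B}V^{\pi_B}_{\mathcal M_B}(\nu_0),$$ the suprema being over all history-dependent policies and over all randomized nonstationary belief policies. 5. For every stationary belief policy, i.e. Markov kernel $\kappa$ from $B$ to $A$, the Bellman backup $(\mathcal T_\kappa V)(b)=\int_A\int_B\big(r_B(b,a)+\gamma V(b')\big)P_B(db'\mid b,a)\,\kappa(da\mid b)$ maps the space of bounded measurable functions on $B$ to itself and is a $\gamma$-contraction for the sup norm; the function $V^\kappa_{\mathcal M_B}$ is bounded and measurable, is the unique fixed point of $\mathcal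 T_\kappa$ in this space, and $\|\mathcal T_\kappa^kV-V^\kappa_{\mathcal M_B}\|_\infty\le\gamma^k\|V-V^\kappa_{\mathcal M_B}\|_\infty$ for every bounded measurable $V$ and every $k\ge0$. -/

import Mathlib

open MeasureTheory ProbabilityTheory

/-- A discounted Markov decision process `(X, A, P, r, γ)` with bounded measurable reward. -/
structure DiscountedMDP (X A : Type*) [MeasurableSpace X] [MeasurableSpace A] where
  P : Kernel (X × A) X
  markovP : IsMarkovKernel P
  r : X × A → ℝ
  measurable_r : Measurable r
  bounded_r : ∃ R : ℝ, ∀ p, |r p| ≤ R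
  γ : ℝ
  γ_pos : 0 < γ
  γ_lt_one : γ < 1

/-- A randomized, possibly time-dependent, Markov policy: at time `t` in state `x` the action has
law `kernel t x`. -/
structure NonstationaryPolicy (X A : Type*) [MeasurableSpace X] [MeasurableSpace A] where
  kernel : ℕ → Kernel X A
  markov : ∀ t, IsMarkovKernel (kernel t)

/-- The policy that uses the same Markov kernel at every time. -/
def NonstationaryPolicy.stationary {X A : Type*} [MeasurableSpace X] [MeasurableSpace A]
    (κ : Kernel X A) [hκ : IsMarkovKernel κ] : NonstationaryPolicy X A where
  kernel _ := κ
  markov _ := hκ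

namespace DiscountedMDP

variable {X A : Type*} [MeasurableSpace X] [MeasurableSpace A]

/-- The conditional law of `(x_{t+1}, a_{t+1})` given `(x_i, a_i)` for `i ≤ t`:
`x_{t+1} ∼ P(· | x_t, a_t)` and then `a_{t+1} ∼ π_{t+1}(· | x_{t+1})`. -/
noncomputable def stepKernel (M : DiscountedMDP X A) (π : NonstationaryPolicy X A) (t : ℕ) :
    Kernel (Π _ : Finset.Iic t, X × A) (X × A) :=
  (M.P ⊗ₖ (π.kernel (t + 1)).comap Prod.snd measurable_snd).comap
    (fun y ↦ y ⟨t, Finset.mem_Iic.2 le_rfl⟩) (measurable_pi_apply _)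

instance (M : DiscountedMDP X A) (π : NonstationaryPolicy X A) (t : ℕ) :
    IsMarkovKernel (M.stepKernel π t) := by
  have := M.markovP
  have := π.markov (t + 1)
  unfold stepKernel
  infer_instance

/-- The law of the whole state-action trajectory `((x_t, a_t))_{t ≥ 0}` started at `x_0 = x`. -/
noncomputable def trajLaw (M : DiscountedMDP X A) (π : NonstationaryPolicy X A) (x : X) :
    Measure (ℕ → X × A) :=
  Kernel.trajMeasure (X := fun _ ↦ X × A) (Measure.dirac x ⊗ₘ π.kernel 0) (M.stepKernel π)

/-- The expected discounted return `𝔼[∑ₜ γᵗ r(x_t, a_t)]` from `x_0 = x`. -/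
noncomputable def value (M : DiscountedMDP X A) (π : NonstationaryPolicy X A) (x : X) : ℝ :=
  ∫ ω, ∑' t, M.γ ^ t * M.r (ω t) ∂M.trajLaw π x

/-- The optimal value over randomized nonstationary Markov policies. -/
noncomputable def optimalValue (M : DiscountedMDP X A) (x : X) : ℝ :=
  ⨆ π : NonstationaryPolicy X A, M.value π x

/-- The Bellman backup of a stationary policy,
`(T V)(x) = ∫∫ (r(x, a) + γ V(x')) P(dx' | x, a) κ(da | x)`. -/
noncomputable def bellman (M : DiscountedMDP X A) (κ : Kernel X A) (V : X → ℝ) (x : X) : ℝ :=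
  ∫ a, ∫ x', (M.r (x, a) + M.γ * V x') ∂M.P (x, a) ∂κ x

end DiscountedMDP

/-- Membership in the space of bounded measurable real functions. -/
def IsBoundedMeasurable {X : Type*} [MeasurableSpace X] (V : X → ℝ) : Prop :=
  Measurable V ∧ ∃ C : ℝ, ∀ x, |V x| ≤ C

/-- The sup norm of a bounded function (`0` on the empty space). -/
noncomputable def supNorm {X : Type*} (V : X → ℝ) : ℝ := ⨆ x, |V x|

/-- The evaluation kernel `b ↦ b` from the space of beliefs to the state space. -/
noncomputable def beliefKernel (S : Type*) [MeasurableSpace S] :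
    Kernel (ProbabilityMeasure S) S where
  toFun b := (b : Measure S)
  measurable' := measurable_subtype_coe

instance (S : Type*) [MeasurableSpace S] : IsMarkovKernel (beliefKernel S) :=
  ⟨fun b ↦ b.2⟩

/-- A discounted partially observed Markov decision process `(S, A, O, P, G, r, γ, ν₀)`.
`P (s, a)` is the law of the next state `s'`, and `G (s', a)` the law of the observation made
after action `a` has led to `s'`. -/
structure DiscountedPOMDP (S A O : Type*) [MeasurableSpace S] [MeasurableSpace A]
    [MeasurableSpace O] where
  P : Kernel (S × A) S
  markovP : IsMarkovKernel P
  G : Kernel (S × A) O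
  markovG : IsMarkovKernel G
  r : S × A → ℝ
  measurable_r : Measurable r
  bounded_r : ∃ R : ℝ, ∀ p, |r p| ≤ R
  γ : ℝ
  γ_pos : 0 < γ
  γ_lt_one : γ < 1
  ν₀ : ProbabilityMeasure S

/-- A randomized history-dependent policy: at time `t`, after the history
`h_t = (a_0, o_1, …, a_{t-1}, o_t)`, the action has law `kernel t h_t`. Entry `i` of a history
is `(a_i, o_{i+1})`. -/
structure HistoryPolicy (A O : Type*) [MeasurableSpace A] [MeasurableSpace O] where
  kernel : (t : ℕ) → Kernel (Fin t → A × O) A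
  markov : ∀ t, IsMarkovKernel (kernel t)

namespace DiscountedPOMDP

variable {S A O : Type*} [MeasurableSpace S] [MeasurableSpace A] [MeasurableSpace O]

/-- The joint law `P(ds' | s, a) G(do | s', a)` of next state and observation. -/
noncomputable def envKernel (M : DiscountedPOMDP S A O) : Kernel (S × A) (S × O) :=
  M.P ⊗ₖ M.G.comap (fun p : (S × A) × S ↦ (p.2, p.1.2)) (by fun_prop)

instance (M : DiscountedPOMDP S A O) : IsMarkovKernel M.envKernel := by
  have := M.markovP
  have := M.markovG
  unfold envKernel
  infer_instance

/-! ### The controlled process -/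

/-- The law of `(s_t, a_t, s_{t+1}, o_{t+1})` given the state `s_t` and the history `h_t`. -/
noncomputable def transition (M : DiscountedPOMDP S A O) (π : HistoryPolicy A O) (t : ℕ) :
    Kernel (S × (Fin t → A × O)) (S × A × S × O) :=
  Kernel.deterministic Prod.fst measurable_fst ×ₖ
    ((π.kernel t).comap Prod.snd measurable_snd ⊗ₖ
      M.envKernel.comap (fun p : (S × (Fin t → A × O)) × A ↦ (p.1.1, p.2)) (by fun_prop))

instance (M : DiscountedPOMDP S A O) (π : HistoryPolicy A O) (t : ℕ) :
    IsMarkovKernel (M.transition π t) := by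
  have := π.markov t
  unfold transition
  infer_instance

/-- The conditional law of `(s_{t+1}, a_{t+1}, s_{t+2}, o_{t+2})` given
`(s_i, a_i, s_{i+1}, o_{i+1})` for `i ≤ t`; it depends on the past only through `s_{t+1}` and
`h_{t+1} = (a_0, o_1, …, a_t, o_{t+1})`. -/
noncomputable def stepKernel (M : DiscountedPOMDP S A O) (π : HistoryPolicy A O) (t : ℕ) :
    Kernel (Π _ : Finset.Iic t, S × A × S × O) (S × A × S × O) :=
  (M.transition π (t + 1)).comap
    (fun y ↦ ((y ⟨t, Finset.mem_Iic.2 le_rfl⟩).2.2.1, fun i : Fin (t + 1) ↦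
      ((y ⟨i, Finset.mem_Iic.2 (Nat.lt_succ_iff.1 i.2)⟩).2.1,
        (y ⟨i, Finset.mem_Iic.2 (Nat.lt_succ_iff.1 i.2)⟩).2.2.2)))
    (by fun_prop)

instance (M : DiscountedPOMDP S A O) (π : HistoryPolicy A O) (t : ℕ) :
    IsMarkovKernel (M.stepKernel π t) := by
  unfold stepKernel
  infer_instance

/-- The law of the whole trajectory under `π` with `s_0 ∼ ν₀`. The coordinate `ω t` of a
trajectory is `(s_t, a_t, s_{t+1}, o_{t+1})`. -/
noncomputable def trajLaw (M : DiscountedPOMDP S A O) (π : HistoryPolicy A O) :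
    Measure (ℕ → S × A × S × O) :=
  Kernel.trajMeasure (X := fun _ ↦ S × A × S × O)
    (((M.ν₀ : Measure S).map fun s ↦ (s, (Fin.elim0 : Fin 0 → A × O))).bind (M.transition π 0))
    (M.stepKernel π)

/-- The state `s_t`. -/
def stateAt (t : ℕ) (ω : ℕ → S × A × S × O) : S := (ω t).1

/-- The action `a_t`. -/
def actionAt (t : ℕ) (ω : ℕ → S × A × S × O) : A := (ω t).2.1

/-- The history `h_t = (a_0, o_1, …, a_{t-1}, o_t)`. -/
def historyAt (t : ℕ) (ω : ℕ → S × A × S × O) : Fin t → A × O :=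
  fun i ↦ ((ω i).2.1, (ω i).2.2.2)

/-- The expected discounted return `𝔼[∑ₜ γᵗ r(s_t, a_t)]` with `s_0 ∼ ν₀`. -/
noncomputable def value (M : DiscountedPOMDP S A O) (π : HistoryPolicy A O) : ℝ :=
  ∫ ω, ∑' t, M.γ ^ t * M.r (stateAt t ω, actionAt t ω) ∂M.trajLaw π

/-- The optimal value over randomized history-dependent policies. -/
noncomputable def optimalValue (M : DiscountedPOMDP S A O) : ℝ :=
  ⨆ π : HistoryPolicy A O, M.value π

/-! ### The belief process -/

/-- The joint law of `(s', o)` under `b(ds) P(ds' | s, a) G(do | s', a)`. -/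
noncomputable def jointKernel (M : DiscountedPOMDP S A O) :
    Kernel (ProbabilityMeasure S × A) (S × O) :=
  M.envKernel ∘ₖ (beliefKernel S ∥ₖ Kernel.id)

instance (M : DiscountedPOMDP S A O) : IsMarkovKernel M.jointKernel := by
  unfold jointKernel
  infer_instance

/-- The predictive observation law `ℓ(· | b, a)`. -/
noncomputable def predictive (M : DiscountedPOMDP S A O) :
    Kernel (ProbabilityMeasure S × A) O :=
  M.jointKernel.snd

instance (M : DiscountedPOMDP S A O) : IsMarkovKernel M.predictive := by
  unfold predictive
  infer_instance

/-- `ℓ(E | b, a) = ∫∫ G(E | s', a) P(ds' | s, a) b(ds)`. -/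
theorem predictive_apply (M : DiscountedPOMDP S A O) (b : ProbabilityMeasure S) (a : A)
    {E : Set O} (hE : MeasurableSet E) :
    M.predictive (b, a) E = ∫⁻ s, ∫⁻ s', M.G (s', a) E ∂M.P (s, a) ∂(b : Measure S) := by
  have := M.markovP
  have := M.markovG
  have hE' : MeasurableSet (Prod.snd ⁻¹' E : Set (S × O)) := measurable_snd hE
  rw [predictive, Kernel.snd_apply' _ _ hE, jointKernel, Kernel.comp_apply' _ _ _ hE',
    Kernel.parallelComp_apply, Kernel.id_apply,
    lintegral_prod _ (Kernel.measurable_coe _ hE').aemeasurable]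
  refine lintegral_congr fun s ↦ ?_
  have hm : Measurable fun y : A ↦ M.envKernel (s, y) (Prod.snd ⁻¹' E) :=
    (Kernel.measurable_coe M.envKernel hE').comp measurable_prodMk_left
  rw [lintegral_dirac' _ hm, envKernel, Kernel.compProd_apply hE']
  rfl

/-- A measurable Bayes update: a measurable map `τ` such that, for every prior belief `b` and
action `a`, `o ↦ τ (b, a, o)` is a version of the conditional law of `s'` given the
observation `o` when `(s', o)` has the law `b(ds) P(ds' | s, a) G(do | s', a)`. -/
structure BayesUpdate (M : DiscountedPOMDP S A O) where
  τ : ProbabilityMeasure S × A × O → ProbabilityMeasure S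
  measurable_τ : Measurable τ
  isPosterior : ∀ (b : ProbabilityMeasure S) (a : A) (U : Set S) (E : Set O),
    MeasurableSet U → MeasurableSet E →
      M.jointKernel (b, a) (U ×ˢ E) =
        ∫⁻ o in E, (τ (b, a, o) : Measure S) U ∂M.predictive (b, a)

/-- The belief transition kernel: `P_B(· | b, a)` is the image of `ℓ(· | b, a)` under
`o ↦ τ(b, a, o)`. -/
noncomputable def beliefTransition (M : DiscountedPOMDP S A O) (u : M.BayesUpdate) :
    Kernel (ProbabilityMeasure S × A) (ProbabilityMeasure S) :=
  (Kernel.id ×ₖ M.predictive).map fun p ↦ u.τ (p.1.1, p.1.2, p.2)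

theorem BayesUpdate.measurable_uncurried {M : DiscountedPOMDP S A O} (u : M.BayesUpdate) :
    Measurable fun p : (ProbabilityMeasure S × A) × O ↦ u.τ (p.1.1, p.1.2, p.2) :=
  u.measurable_τ.comp (by fun_prop)

instance (M : DiscountedPOMDP S A O) (u : M.BayesUpdate) :
    IsMarkovKernel (M.beliefTransition u) := by
  unfold beliefTransition
  exact Kernel.IsMarkovKernel.map _ u.measurable_uncurried

/-- `P_B(C | b, a) = ∫ 1{τ(b, a, o) ∈ C} ℓ(do | b, a)`. -/
theorem beliefTransition_apply (M : DiscountedPOMDP S A O) (u : M.BayesUpdate)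
    (b : ProbabilityMeasure S) (a : A) {C : Set (ProbabilityMeasure S)} (hC : MeasurableSet C) :
    M.beliefTransition u (b, a) C = M.predictive (b, a) {o | u.τ (b, a, o) ∈ C} := by
  rw [beliefTransition, Kernel.map_apply' _ u.measurable_uncurried _ hC,
    Kernel.prod_apply, Kernel.id_apply, Measure.prod_apply (u.measurable_uncurried hC),
    lintegral_dirac' _ (measurable_measure_prodMk_left (u.measurable_uncurried hC))]
  rfl

/-- The lifted reward `r_B(b, a) = ∫ r(s, a) b(ds)`. -/
noncomputable def beliefReward (M : DiscountedPOMDP S A O) (p : ProbabilityMeasure S × A) : ℝ :=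
  ∫ s, M.r (s, p.2) ∂(p.1 : Measure S)

theorem measurable_beliefReward (M : DiscountedPOMDP S A O) : Measurable M.beliefReward := by
  have h : StronglyMeasurable
      fun q : (ProbabilityMeasure S × A) × S ↦ M.r (q.2, q.1.2) :=
    (M.measurable_r.comp (by fun_prop)).stronglyMeasurable
  exact (h.integral_kernel_prod_right'
    (κ := (beliefKernel S).comap (Prod.fst : ProbabilityMeasure S × A → _)
      measurable_fst)).measurable

theorem abs_beliefReward_le (M : DiscountedPOMDP S A O) {R : ℝ} (hR : ∀ p, |M.r p| ≤ R)
    (p : ProbabilityMeasure S × A) : |M.beliefReward p| ≤ R := by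
  have h := norm_integral_le_of_norm_le_const (μ := (p.1 : Measure S))
    (f := fun s ↦ M.r (s, p.2)) (C := R) (Filter.Eventually.of_forall fun s ↦ hR _)
  simpa [beliefReward] using h

/-- The belief MDP `(B, A, P_B, r_B, γ)` on the belief space `B = Δ(S)`. -/
noncomputable def beliefMDP (M : DiscountedPOMDP S A O) (u : M.BayesUpdate) :
    DiscountedMDP (ProbabilityMeasure S) A where
  P := M.beliefTransition u
  markovP := inferInstance
  r := M.beliefReward
  measurable_r := M.measurable_beliefReward
  bounded_r := M.bounded_r.imp fun _ hR ↦ M.abs_beliefReward_le hR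
  γ := M.γ
  γ_pos := M.γ_pos
  γ_lt_one := M.γ_lt_one

/-- The belief as a function of the history: `b_0 = ν₀`, `b_{t+1} = τ(b_t, a_t, o_{t+1})`. -/
noncomputable def belief (M : DiscountedPOMDP S A O) (u : M.BayesUpdate) :
    (t : ℕ) → (Fin t → A × O) → ProbabilityMeasure S
  | 0, _ => M.ν₀
  | t + 1, h => u.τ (M.belief u t (fun i ↦ h i.castSucc), (h (Fin.last t)).1, (h (Fin.last t)).2)

end DiscountedPOMDP

/-! The belief is a sufficient statistic. Suppose that given `h_t` the hidden state has law `b_t`.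
The action is drawn from `h_t` alone, so it reveals nothing more about `s_t`; given `(h_t, a_t)` the
next observation has the predictive law at `(b_t, a_t)`, and conditioning on it turns the belief
into `τ(b_t, a_t, o_{t+1}) = b_{t+1}`. This induction is `isFilterAt`, with
`IsFilterAt.lintegral_next` as its step. It is phrased with nonnegative integrals, so that Tonelli
applies without integrability conditions. Consequently beliefs move by `P_B`
(`fst_beliefActionLaw_succ`), and `r(s_t, a_t)` and `r_B(b_t, a_t)` have the same mean
(`integral_reward`).

A discounted return depends on the process only through the laws of the state-action pairs at single
times. Under a history policy `(b_t)` need not be Markov, but if `π_{B,t}` is a conditional law of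
`a_t` given `b_t`, the laws of `(b_t, a_t)` satisfy the recursion of the belief MDP under `π_B`
(`beliefActionLaw_eq_marginal`). Disintegration supplies such a `π_B` for any `π`; feeding beliefs
to `π_B` supplies a `π` for any `π_B`. Equality of the suprema follows.

The Bellman claims hold in any discounted MDP: the backup is affine in `V`, with linear part `γ`
times a Markov kernel. -/

/-! ### Trajectory measures -/

section TrajMeasure

variable {X : ℕ → Type*} [∀ n, MeasurableSpace (X n)]

/-- The first point of a trajectory has the prescribed initial law. -/
theorem map_eval_zero_trajMeasure (μ : Measure (X 0)) [IsProbabilityMeasure μ]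
    (κ : (n : ℕ) → Kernel (Π i : Finset.Iic n, X i) (X (n + 1))) [∀ n, IsMarkovKernel (κ n)] :
    (Kernel.trajMeasure μ κ).map (fun ω ↦ ω 0) = μ := by
  let g : (Π i : Finset.Iic 0, X i) → X 0 := fun y ↦ y ⟨0, Finset.mem_Iic.2 le_rfl⟩
  have hg : Measurable g := measurable_pi_apply _
  have hf : (fun ω : Π n, X n ↦ ω 0) = g ∘ Preorder.frestrictLe 0 := rfl
  rw [hf, ← Measure.map_map hg (by fun_prop), Kernel.trajMeasure,
    Measure.map_comp _ _ (by fun_prop), Kernel.traj_map_frestrictLe, Kernel.partialTraj_self,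
    Measure.id_comp]
  exact (Measure.map_map hg (MeasurableEquiv.measurable _)).trans Measure.map_id

/-- Integration over the next point of a trajectory, jointly with the past. -/
theorem lintegral_trajMeasure_succ (μ : Measure (X 0)) [IsProbabilityMeasure μ]
    (κ : (n : ℕ) → Kernel (Π i : Finset.Iic n, X i) (X (n + 1))) [∀ n, IsMarkovKernel (κ n)]
    (t : ℕ) {f : (Π i : Finset.Iic t, X i) × X (t + 1) → ENNReal} (hf : Measurable f) :
    ∫⁻ ω, f (Preorder.frestrictLe t ω, ω (t + 1)) ∂Kernel.trajMeasure μ κ =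
      ∫⁻ ω, ∫⁻ y, f (Preorder.frestrictLe t ω, y) ∂κ t (Preorder.frestrictLe t ω)
        ∂Kernel.trajMeasure μ κ := by
  have h := Kernel.map_frestrictLe_trajMeasure_compProd_eq_map_trajMeasure
    (μ₀ := μ) (κ := κ) (a := t)
  have h2 : ∫⁻ p, f p ∂_ = ∫⁻ p, f p ∂_ := congrArg (fun ν ↦ ∫⁻ p, f p ∂ν) h
  rw [lintegral_map hf (by fun_prop), Measure.lintegral_compProd hf,
    lintegral_map (hf.lintegral_kernel_prod_right' (κ := κ t)) (by fun_prop)] at h2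
  exact h2.symm

end TrajMeasure

/-! ### Discounted sums and the sup norm -/

/-- The expectation of a discounted sum of uniformly bounded rewards is the discounted sum of the
expectations. -/
theorem integral_tsum_discounted {Ω : Type*} [MeasurableSpace Ω] (μ : Measure Ω)
    [IsProbabilityMeasure μ] {γ R : ℝ} (h0 : 0 < γ) (h1 : γ < 1) {f : ℕ → Ω → ℝ}
    (hf : ∀ t, Measurable (f t)) (hR : ∀ t ω, |f t ω| ≤ R) :
    ∫ ω, ∑' t, γ ^ t * f t ω ∂μ = ∑' t, γ ^ t * ∫ ω, f t ω ∂μ := by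
  have hb : ∀ t ω, ‖γ ^ t * f t ω‖ ≤ γ ^ t * R := fun t ω ↦ by
    rw [norm_mul, Real.norm_of_nonneg (pow_nonneg h0.le t), Real.norm_eq_abs]
    exact mul_le_mul_of_nonneg_left (hR t ω) (pow_nonneg h0.le t)
  have hint : ∀ t, Integrable (fun ω ↦ γ ^ t * f t ω) μ := fun t ↦
    .of_bound ((hf t).const_mul _).aestronglyMeasurable _ (.of_forall (hb t))
  rw [← integral_tsum_of_summable_integral_norm hint]
  · simp_rw [integral_const_mul]
  · refine ((summable_geometric_of_lt_one h0.le h1).mul_right R).of_nonneg_of_le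
      (fun t ↦ integral_nonneg fun ω ↦ norm_nonneg _) fun t ↦ ?_
    refine (integral_mono (hint t).norm (integrable_const (γ ^ t * R)) (hb t)).trans ?_
    simp

theorem summable_discounted {γ R : ℝ} (h0 : 0 < γ) (h1 : γ < 1) {c : ℕ → ℝ}
    (hc : ∀ t, |c t| ≤ R) : Summable fun t ↦ γ ^ t * c t := by
  refine ((summable_geometric_of_lt_one h0.le h1).mul_right R).of_norm_bounded fun t ↦ ?_
  rw [norm_mul, Real.norm_of_nonneg (pow_nonneg h0.le t), Real.norm_eq_abs]
  exact mul_le_mul_of_nonneg_left (hc t) (pow_nonneg h0.le t)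

theorem abs_tsum_discounted_le {γ R : ℝ} (h0 : 0 < γ) (h1 : γ < 1) {c : ℕ → ℝ}
    (hc : ∀ t, |c t| ≤ R) : |∑' t, γ ^ t * c t| ≤ (1 - γ)⁻¹ * R := by
  have hs := (hasSum_geometric_of_lt_one h0.le h1).mul_right R
  rw [← Real.norm_eq_abs]
  refine tsum_of_norm_bounded hs fun t ↦ ?_
  rw [norm_mul, Real.norm_of_nonneg (pow_nonneg h0.le t), Real.norm_eq_abs]
  exact mul_le_mul_of_nonneg_left (hc t) (pow_nonneg h0.le t)

theorem abs_integral_le_of_abs_le {Ω : Type*} [MeasurableSpace Ω] (μ : Measure Ω)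
    [IsProbabilityMeasure μ] {f : Ω → ℝ} {R : ℝ} (hR : ∀ ω, |f ω| ≤ R) : |∫ ω, f ω ∂μ| ≤ R := by
  simpa using norm_integral_le_of_norm_le_const (μ := μ) (f := f) (C := R) (.of_forall hR)

theorem abs_integral_tsum_discounted_le {Ω : Type*} [MeasurableSpace Ω] (μ : Measure Ω)
    [IsProbabilityMeasure μ] {γ R : ℝ} (h0 : 0 < γ) (h1 : γ < 1) {f : ℕ → Ω → ℝ}
    (hR : ∀ t ω, |f t ω| ≤ R) : |∫ ω, ∑' t, γ ^ t * f t ω ∂μ| ≤ (1 - γ)⁻¹ * R :=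
  abs_integral_le_of_abs_le μ fun ω ↦ abs_tsum_discounted_le h0 h1 fun t ↦ hR t ω

section SupNorm

variable {X : Type*} {V W : X → ℝ}

theorem supNorm_nonneg (V : X → ℝ) : 0 ≤ supNorm V := Real.iSup_nonneg fun _ ↦ abs_nonneg _

/-- The assumption `0 ≤ C` covers the empty space, where the supremum is `0`. -/
theorem supNorm_le {C : ℝ} (hC : 0 ≤ C) (h : ∀ x, |V x| ≤ C) : supNorm V ≤ C :=
  Real.iSup_le h hC

/-- Boundedness is essential: the real supremum of an unbounded family is `0` by convention. -/
theorem abs_le_supNorm (h : ∃ C : ℝ, ∀ x, |V x| ≤ C) (x : X) : |V x| ≤ supNorm V :=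
  le_ciSup (f := fun x ↦ |V x|) (h.imp fun _ hC ↦ Set.forall_mem_range.2 hC) x

theorem IsBoundedMeasurable.sub [MeasurableSpace X] (hV : IsBoundedMeasurable V)
    (hW : IsBoundedMeasurable W) : IsBoundedMeasurable (V - W) := by
  obtain ⟨hVm, C, hC⟩ := hV
  obtain ⟨hWm, D, hD⟩ := hW
  exact ⟨hVm.sub hWm, C + D, fun x ↦ (abs_sub _ _).trans (add_le_add (hC x) (hD x))⟩

theorem IsBoundedMeasurable.integrable [MeasurableSpace X] (hV : IsBoundedMeasurable V)
    (μ : Measure X) [IsFiniteMeasure μ] : Integrable V μ :=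
  .of_bound hV.1.aestronglyMeasurable _ (.of_forall hV.2.choose_spec)

end SupNorm

/-! ### One-time marginals and returns of a fully observed process -/

namespace DiscountedMDP

variable {X A : Type*} [MeasurableSpace X] [MeasurableSpace A]

instance (M : DiscountedMDP X A) : IsMarkovKernel M.P := M.markovP

instance (π : NonstationaryPolicy X A) (t : ℕ) : IsMarkovKernel (π.kernel t) := π.markov t

instance (M : DiscountedMDP X A) (π : NonstationaryPolicy X A) (x : X) :
    IsProbabilityMeasure (M.trajLaw π x) := by
  unfold trajLaw
  infer_instance

/-- The law of `(x_t, a_t)` as a kernel in the initial state. -/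
noncomputable def marginal (M : DiscountedMDP X A) (π : NonstationaryPolicy X A) :
    ℕ → Kernel X (X × A)
  | 0 => Kernel.id ×ₖ π.kernel 0
  | t + 1 => (Kernel.id ×ₖ π.kernel (t + 1)) ∘ₖ (M.P ∘ₖ M.marginal π t)

instance (M : DiscountedMDP X A) (π : NonstationaryPolicy X A) (t : ℕ) :
    IsMarkovKernel (M.marginal π t) := by
  induction t with
  | zero => unfold marginal; infer_instance
  | succ t ih => unfold marginal; infer_instance

/-- Ties the trajectory measure to a recursion between kernels. Later arguments on the MDP use only
this recursion, which is also visibly measurable in the initial state. -/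
theorem map_eval_trajLaw (M : DiscountedMDP X A) (π : NonstationaryPolicy X A) (x : X) (t : ℕ) :
    (M.trajLaw π x).map (fun ω ↦ ω t) = M.marginal π t x := by
  induction t with
  | zero =>
    rw [trajLaw, map_eval_zero_trajMeasure, marginal, Kernel.prod_apply, Kernel.id_apply]
    refine Measure.ext_of_lintegral _ fun f hf ↦ ?_
    rw [Measure.lintegral_compProd hf, lintegral_prod _ hf.aemeasurable,
      lintegral_dirac' _ (hf.lintegral_kernel_prod_right' (κ := π.kernel 0)),
      lintegral_dirac' _ hf.lintegral_prod_right']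
  | succ t ih =>
    refine Measure.ext_of_lintegral _ fun f hf ↦ ?_
    have hg : Measurable fun x' ↦ ∫⁻ a, f (x', a) ∂π.kernel (t + 1) x' :=
      hf.lintegral_kernel_prod_right'
    rw [lintegral_map hf (by fun_prop), trajLaw]
    refine (lintegral_trajMeasure_succ (X := fun _ ↦ X × A) _ (M.stepKernel π) t
      (f := fun p ↦ f p.2) (by fun_prop)).trans ?_
    rw [← trajLaw, marginal, Kernel.lintegral_comp _ _ _ hf]
    simp_rw [Kernel.lintegral_id_prod hf]
    rw [Kernel.lintegral_comp _ _ _ hg, ← ih, lintegral_map hg.lintegral_kernel (by fun_prop)]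
    refine lintegral_congr fun ω ↦ ?_
    rw [stepKernel, Kernel.lintegral_comap, Kernel.lintegral_compProd _ _ _ hf]
    rfl

theorem value_eq_tsum (M : DiscountedMDP X A) (π : NonstationaryPolicy X A) (x : X) :
    M.value π x = ∑' t, M.γ ^ t * ∫ p, M.r p ∂M.marginal π t x := by
  obtain ⟨R, hR⟩ := M.bounded_r
  rw [value, integral_tsum_discounted (M.trajLaw π x) M.γ_pos M.γ_lt_one
    (f := fun t ω ↦ M.r (ω t)) (fun t ↦ M.measurable_r.comp (measurable_pi_apply t)) fun t ω ↦ hR _]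
  simp_rw [← map_eval_trajLaw]
  congr! 3 with t
  exact (integral_map (measurable_pi_apply t).aemeasurable
    M.measurable_r.aestronglyMeasurable).symm

theorem abs_value_le (M : DiscountedMDP X A) {R : ℝ} (hR : ∀ p, |M.r p| ≤ R)
    (π : NonstationaryPolicy X A) (x : X) : |M.value π x| ≤ (1 - M.γ)⁻¹ * R :=
  abs_integral_tsum_discounted_le _ M.γ_pos M.γ_lt_one fun _ _ ↦ hR _

theorem isBoundedMeasurable_value (M : DiscountedMDP X A) (π : NonstationaryPolicy X A) :
    IsBoundedMeasurable (M.value π) := by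
  obtain ⟨R, hR⟩ := M.bounded_r
  refine ⟨?_, _, M.abs_value_le hR π⟩
  rw [funext (M.value_eq_tsum π)]
  refine Measurable.tsum fun t ↦ ?_
  exact (M.measurable_r.stronglyMeasurable.integral_kernel
    (κ := M.marginal π t)).measurable.const_mul _

/-! ### The Bellman backup of a stationary policy -/

/-- The state transition kernel under a stationary policy. -/
noncomputable def policyTransition (M : DiscountedMDP X A) (κ : Kernel X A) : Kernel X X :=
  M.P ∘ₖ (Kernel.id ×ₖ κ)

variable (M : DiscountedMDP X A) (κ : Kernel X A) [IsMarkovKernel κ]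

instance : IsMarkovKernel (M.policyTransition κ) := by
  unfold policyTransition
  infer_instance

theorem integral_id_prod {f : X × A → ℝ} (hf : Measurable f) (x : X) :
    ∫ p, f p ∂(Kernel.id ×ₖ κ) x = ∫ a, f (x, a) ∂κ x := by
  rw [Kernel.prod_apply, Kernel.id_apply, Measure.dirac_prod,
    integral_map (by fun_prop) hf.aestronglyMeasurable]

/-- The definition of `marginal` splits off the last step; this splits off the first. Both are
bracketings of one composition of kernels, since a stationary policy is unchanged by a time shift.
-/
theorem marginal_stationary_succ (t : ℕ) :
    M.marginal (.stationary κ) (t + 1) =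
      M.marginal (.stationary κ) t ∘ₖ M.policyTransition κ := by
  induction t with
  | zero => rfl
  | succ t ih =>
    conv_lhs => rw [marginal, ih, ← Kernel.comp_assoc, ← Kernel.comp_assoc,
      Kernel.comp_assoc _ M.P]
    rfl

/-- This form displays the backup as a reward term free of `V` plus `γ` times an average of `V`;
measurability, contraction and the fixed point are read off from it. -/
theorem bellman_eq {V : X → ℝ} (hV : IsBoundedMeasurable V) (x : X) :
    M.bellman κ V x = ∫ a, M.r (x, a) ∂κ x + M.γ * ∫ x', V x' ∂M.policyTransition κ x := by
  have hr : IsBoundedMeasurable fun a ↦ M.r (x, a) :=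
    ⟨M.measurable_r.comp measurable_prodMk_left, M.bounded_r.imp fun _ h a ↦ h _⟩
  have hPm : Measurable fun p ↦ ∫ x', V x' ∂M.P p :=
    (hV.1.stronglyMeasurable.integral_kernel (κ := M.P)).measurable
  have hP : IsBoundedMeasurable fun a ↦ M.γ * ∫ x', V x' ∂M.P (x, a) := by
    obtain ⟨C, hC⟩ := hV.2
    refine ⟨(hPm.comp measurable_prodMk_left).const_mul _, M.γ * C, fun a ↦ ?_⟩
    rw [abs_mul, abs_of_pos M.γ_pos]
    exact mul_le_mul_of_nonneg_left (abs_integral_le_of_abs_le _ hC) M.γ_pos.le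
  have hi : ∀ a, ∫ x', (M.r (x, a) + M.γ * V x') ∂M.P (x, a) =
      M.r (x, a) + M.γ * ∫ x', V x' ∂M.P (x, a) := fun a ↦ by
    rw [integral_add (integrable_const _) ((hV.integrable _).const_mul _), integral_const_mul]
    simp
  simp_rw [bellman, hi]
  rw [integral_add (hr.integrable _) (hP.integrable _), integral_const_mul, policyTransition,
    Kernel.integral_comp (hV.integrable _), integral_id_prod κ hPm]

theorem isBoundedMeasurable_bellman {V : X → ℝ} (hV : IsBoundedMeasurable V) :
    IsBoundedMeasurable (M.bellman κ V) := by
  obtain ⟨R, hR⟩ := M.bounded_r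
  obtain ⟨C, hC⟩ := hV.2
  refine ⟨?_, R + M.γ * C, fun x ↦ ?_⟩
  · rw [funext (M.bellman_eq κ hV)]
    exact (M.measurable_r.stronglyMeasurable.integral_kernel_prod_right' (κ := κ)).measurable.add
      ((hV.1.stronglyMeasurable.integral_kernel (κ := M.policyTransition κ)).measurable.const_mul _)
  · rw [M.bellman_eq κ hV]
    refine (abs_add_le _ _).trans (add_le_add (abs_integral_le_of_abs_le _ fun a ↦ hR _) ?_)
    rw [abs_mul, abs_of_pos M.γ_pos]
    exact mul_le_mul_of_nonneg_left (abs_integral_le_of_abs_le _ hC) M.γ_pos.le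

/-- The reward terms cancel, and averaging against a probability measure does not increase the sup
norm. -/
theorem supNorm_bellman_sub_le {V W : X → ℝ} (hV : IsBoundedMeasurable V)
    (hW : IsBoundedMeasurable W) :
    supNorm (M.bellman κ V - M.bellman κ W) ≤ M.γ * supNorm (V - W) := by
  refine supNorm_le (mul_nonneg M.γ_pos.le (supNorm_nonneg _)) fun x ↦ ?_
  rw [Pi.sub_apply, M.bellman_eq κ hV, M.bellman_eq κ hW, add_sub_add_left_eq_sub, ← mul_sub,
    ← integral_sub (hV.integrable _) (hW.integrable _), abs_mul, abs_of_pos M.γ_pos]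
  exact mul_le_mul_of_nonneg_left
    (abs_integral_le_of_abs_le _ (abs_le_supNorm (hV.sub hW).2)) M.γ_pos.le

/-- The term `t = 0` of the series is the reward term. By `marginal_stationary_succ` the tail is `γ`
times the series started from the next state, averaged over that state. -/
theorem bellman_value : M.bellman κ (M.value (.stationary κ)) = M.value (.stationary κ) := by
  obtain ⟨R, hR⟩ := M.bounded_r
  funext x
  have hb : ∀ t y, |∫ p, M.r p ∂M.marginal (.stationary κ) t y| ≤ R := fun t y ↦
    abs_integral_le_of_abs_le _ hR
  have hr : IsBoundedMeasurable M.r := ⟨M.measurable_r, M.bounded_r⟩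
  rw [M.bellman_eq κ (M.isBoundedMeasurable_value _), M.value_eq_tsum _ x,
    (summable_discounted M.γ_pos M.γ_lt_one fun t ↦ hb t x).tsum_eq_zero_add]
  congr 1
  · rw [pow_zero, one_mul, marginal]
    exact (integral_id_prod κ M.measurable_r x).symm
  · rw [funext (M.value_eq_tsum _), integral_tsum_discounted _ M.γ_pos M.γ_lt_one
      (fun t ↦ (M.measurable_r.stronglyMeasurable.integral_kernel
        (κ := M.marginal (.stationary κ) t)).measurable) hb, ← tsum_mul_left]
    refine tsum_congr fun t ↦ ?_
    rw [marginal_stationary_succ, Kernel.integral_comp (hr.integrable _), pow_succ']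
    ring

/-- For uniqueness, the distance `d` between two fixed points satisfies `d ≤ γ d` with `γ < 1`, so
`d = 0`. -/
theorem bellman_eq_self_iff {V : X → ℝ} (hV : IsBoundedMeasurable V) :
    M.bellman κ V = V ↔ V = M.value (.stationary κ) := by
  refine ⟨fun h ↦ ?_, fun h ↦ h ▸ M.bellman_value κ⟩
  have hW := M.isBoundedMeasurable_value (.stationary κ)
  have hc := M.supNorm_bellman_sub_le κ hV hW
  rw [h, M.bellman_value κ] at hc
  have h0 : supNorm (V - M.value (.stationary κ)) ≤ 0 := by
    nlinarith [M.γ_lt_one, supNorm_nonneg (V - M.value (.stationary κ))]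
  funext x
  exact sub_eq_zero.1 (abs_nonpos_iff.1 ((abs_le_supNorm (hV.sub hW).2 x).trans h0))

theorem supNorm_iterate_bellman_sub_value_le {V : X → ℝ} (hV : IsBoundedMeasurable V) (k : ℕ) :
    supNorm ((M.bellman κ)^[k] V - M.value (.stationary κ)) ≤
      M.γ ^ k * supNorm (V - M.value (.stationary κ)) := by
  -- The iterate unfolds from the inside, so the induction hypothesis is applied to the backup of
  -- `V`.
  induction k generalizing V with
  | zero => simp
  | succ k ih =>
    have hc := M.supNorm_bellman_sub_le κ hV (M.isBoundedMeasurable_value (.stationary κ))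
    rw [M.bellman_value κ] at hc
    rw [Function.iterate_succ_apply, pow_succ, mul_assoc]
    exact (ih (M.isBoundedMeasurable_bellman κ hV)).trans
      (mul_le_mul_of_nonneg_left hc (pow_nonneg M.γ_pos.le k))

end DiscountedMDP

/-! ### The filter of a partially observed process -/

theorem measurable_finSnoc {α : Type*} [MeasurableSpace α] (t : ℕ) :
    Measurable fun p : (Fin t → α) × α ↦ (Fin.snoc p.1 p.2 : Fin (t + 1) → α) := by
  refine measurable_pi_lambda _ fun i ↦ ?_
  refine Fin.lastCases ?_ (fun j ↦ ?_) i
  · simpa using measurable_snd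
  · simpa using (by fun_prop : Measurable fun p : (Fin t → α) × α ↦ p.1 j)

namespace DiscountedPOMDP

theorem historyAt_succ {S A O : Type*} (t : ℕ) (ω : ℕ → S × A × S × O) :
    historyAt (t + 1) ω =
      (Fin.snoc (historyAt t ω) ((ω t).2.1, (ω t).2.2.2) : Fin (t + 1) → A × O) := by
  funext i
  refine Fin.lastCases ?_ (fun j ↦ ?_) i <;> simp [historyAt]

variable {S A O : Type*} [MeasurableSpace S] [MeasurableSpace A] [MeasurableSpace O]

instance (π : HistoryPolicy A O) (t : ℕ) : IsMarkovKernel (π.kernel t) := π.markov t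

instance (M : DiscountedPOMDP S A O) :
    IsProbabilityMeasure
      ((M.ν₀ : Measure S).map fun s ↦ (s, (Fin.elim0 : Fin 0 → A × O))) :=
  Measure.isProbabilityMeasure_map (by fun_prop)

instance (M : DiscountedPOMDP S A O) (π : HistoryPolicy A O) :
    IsProbabilityMeasure (M.trajLaw π) := by
  unfold trajLaw
  infer_instance

variable (M : DiscountedPOMDP S A O) (u : M.BayesUpdate) (π : HistoryPolicy A O)

theorem measurable_stateAt (t : ℕ) : Measurable (stateAt t : (ℕ → S × A × S × O) → S) := by
  unfold stateAt
  fun_prop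

theorem measurable_actionAt (t : ℕ) : Measurable (actionAt t : (ℕ → S × A × S × O) → A) := by
  unfold actionAt
  fun_prop

theorem measurable_historyAt (t : ℕ) :
    Measurable (historyAt t : (ℕ → S × A × S × O) → (Fin t → A × O)) := by
  unfold historyAt
  fun_prop

theorem measurable_belief (t : ℕ) : Measurable (M.belief u t) := by
  induction t with
  | zero => exact measurable_const
  | succ t ih =>
    refine u.measurable_τ.comp (.prodMk (ih.comp ?_) ?_)
    · exact measurable_pi_lambda _ fun i ↦ measurable_pi_apply _
    · exact measurable_pi_apply (Fin.last t)

theorem belief_snoc (t : ℕ) (h : Fin t → A × O) (a : A) (o : O) :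
    M.belief u (t + 1) (Fin.snoc h (a, o) : Fin (t + 1) → A × O) =
      u.τ (M.belief u t h, a, o) := by
  simp [belief]

/-- The posterior belief `τ(b, a, o)` as a kernel. -/
noncomputable def BayesUpdate.kernel {M : DiscountedPOMDP S A O} (u : M.BayesUpdate) :
    Kernel ((ProbabilityMeasure S × A) × O) S :=
  (beliefKernel S).comap (fun p ↦ u.τ (p.1.1, p.1.2, p.2)) u.measurable_uncurried

instance {M : DiscountedPOMDP S A O} (u : M.BayesUpdate) : IsMarkovKernel u.kernel := by
  unfold BayesUpdate.kernel
  infer_instance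

/-- The Bayes update disintegrates the joint law of next state and observation. -/
theorem jointKernel_eq : M.jointKernel = (M.predictive ⊗ₖ u.kernel).map Prod.swap := by
  ext1 p
  refine Measure.ext_prod fun {U E} hU hE ↦ ?_
  rw [u.isPosterior p.1 p.2 U E hU hE, Kernel.map_apply' _ measurable_swap _ (hU.prod hE),
    Set.preimage_swap_prod, Kernel.compProd_apply (hE.prod hU), ← lintegral_indicator hE]
  refine lintegral_congr fun o ↦ ?_
  by_cases ho : o ∈ E
  · simp only [ho, Set.indicator_of_mem, Set.mk_preimage_prod_right]
    rfl
  · simp [ho]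

theorem lintegral_jointKernel (p : ProbabilityMeasure S × A) {f : S × O → ENNReal}
    (hf : Measurable f) :
    ∫⁻ q, f q ∂M.jointKernel p =
      ∫⁻ o, ∫⁻ s, f (s, o) ∂(u.τ (p.1, p.2, o) : Measure S) ∂M.predictive p := by
  rw [M.jointKernel_eq u, Kernel.lintegral_map _ measurable_swap _ hf,
    Kernel.lintegral_compProd _ _ _ (f := fun q ↦ f q.swap)
      (hf.comp measurable_swap)]
  rfl

/-- Averaging the hidden state over `b` turns the true dynamics into the joint law on which the
Bayes update acts. -/
theorem lintegral_lintegral_envKernel (b : ProbabilityMeasure S) (a : A) {f : S × O → ENNReal}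
    (hf : Measurable f) :
    ∫⁻ s, ∫⁻ q, f q ∂M.envKernel (s, a) ∂(b : Measure S) = ∫⁻ q, f q ∂M.jointKernel (b, a) := by
  have hm : Measurable fun p ↦ ∫⁻ q, f q ∂M.envKernel p := hf.lintegral_kernel
  rw [jointKernel, Kernel.lintegral_comp _ _ _ hf, Kernel.parallelComp_apply, Kernel.id_apply,
    lintegral_prod _ hm.aemeasurable]
  refine lintegral_congr fun s ↦ ?_
  exact (lintegral_dirac' a (hm.comp measurable_prodMk_left)).symm

theorem lintegral_transition (t : ℕ) (s : S) (h : Fin t → A × O) {f : S × A × S × O → ENNReal}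
    (hf : Measurable f) :
    ∫⁻ y, f y ∂M.transition π t (s, h) =
      ∫⁻ a, ∫⁻ q, f (s, a, q) ∂M.envKernel (s, a) ∂π.kernel t h := by
  rw [transition, Kernel.lintegral_deterministic_prod _ _ _ hf,
    Kernel.lintegral_compProd _ _ _ (f := fun q ↦ f (s, q)) (hf.comp measurable_prodMk_left)]
  rfl

/-- The belief at time `t` as a kernel from histories to states. -/
noncomputable def historyBelief (t : ℕ) : Kernel (Fin t → A × O) S :=
  (beliefKernel S).comap (M.belief u t) (M.measurable_belief u t)

instance (t : ℕ) : IsMarkovKernel (M.historyBelief u t) := by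
  unfold historyBelief
  infer_instance

/-- Given `h_t`, the belief is the law of the hidden state from which the process moves on. -/
def IsFilterAt (t : ℕ) : Prop :=
  ∀ F : (Fin t → A × O) × (S × A × S × O) → ENNReal, Measurable F →
    ∫⁻ ω, F (historyAt t ω, ω t) ∂M.trajLaw π =
      ∫⁻ ω, ∫⁻ s, ∫⁻ y, F (historyAt t ω, y) ∂M.transition π t (s, historyAt t ω)
        ∂M.historyBelief u t (historyAt t ω) ∂M.trajLaw π

variable {M u π}

/-- Under the filter property the action is drawn independently of the hidden state. -/
theorem IsFilterAt.lintegral_eq {t : ℕ} (H : M.IsFilterAt u π t)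
    {F : (Fin t → A × O) × (S × A × S × O) → ENNReal} (hF : Measurable F) :
    ∫⁻ ω, F (historyAt t ω, ω t) ∂M.trajLaw π =
      ∫⁻ ω, ∫⁻ a, ∫⁻ s, ∫⁻ q, F (historyAt t ω, s, a, q) ∂M.envKernel (s, a)
        ∂M.historyBelief u t (historyAt t ω) ∂π.kernel t (historyAt t ω) ∂M.trajLaw π := by
  rw [H F hF]
  refine lintegral_congr fun ω ↦ ?_
  simp_rw [fun s ↦ M.lintegral_transition π t s (historyAt t ω)
    (f := fun y ↦ F (historyAt t ω, y)) (hF.comp measurable_prodMk_left)]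
  -- The action law depends on the history and not on `s`, so Tonelli interchanges the two
  -- integrals.
  refine lintegral_lintegral_swap (Measurable.aemeasurable ?_)
  exact Measurable.lintegral_kernel_prod_right' (κ := M.envKernel)
    (f := fun p : (S × A) × (S × O) ↦ F (historyAt t ω, p.1.1, p.1.2, p.2))
    (hF.comp (by fun_prop))

theorem IsFilterAt.lintegral_action {t : ℕ} (H : M.IsFilterAt u π t)
    {f : (Fin t → A × O) × A → ENNReal} (hf : Measurable f) :
    ∫⁻ ω, f (historyAt t ω, actionAt t ω) ∂M.trajLaw π =
      ∫⁻ ω, ∫⁻ a, f (historyAt t ω, a) ∂π.kernel t (historyAt t ω) ∂M.trajLaw π := by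
  refine (H.lintegral_eq (F := fun p ↦ f (p.1, p.2.2.1)) (hf.comp (by fun_prop))).trans ?_
  simp

/-- Knowing `a_t` in addition to `h_t` leaves the law of `s_t` equal to the belief, because the
action was drawn without looking at the state. -/
theorem IsFilterAt.lintegral_state_action {t : ℕ} (H : M.IsFilterAt u π t)
    {f : ((Fin t → A × O) × A) × S → ENNReal} (hf : Measurable f) :
    ∫⁻ ω, f ((historyAt t ω, actionAt t ω), stateAt t ω) ∂M.trajLaw π =
      ∫⁻ ω, ∫⁻ s, f ((historyAt t ω, actionAt t ω), s) ∂M.historyBelief u t (historyAt t ω)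
        ∂M.trajLaw π := by
  have hm := hf.lintegral_kernel_prod_right'
    (κ := (M.historyBelief u t).comap (Prod.fst : _ × A → _) measurable_fst)
  refine (H.lintegral_eq (F := fun p ↦ f ((p.1, p.2.2.1), p.2.1)) (hf.comp (by fun_prop))).trans ?_
  refine Eq.trans ?_ (H.lintegral_action hm).symm
  simp

/-- One step of the filter: the law of the next state and the extended history. -/
theorem IsFilterAt.lintegral_next {t : ℕ} (H : M.IsFilterAt u π t)
    {Φ : S × (Fin (t + 1) → A × O) → ENNReal} (hΦ : Measurable Φ) :
    ∫⁻ ω, Φ ((ω t).2.2.1, historyAt (t + 1) ω) ∂M.trajLaw π =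
      ∫⁻ ω, ∫⁻ o, ∫⁻ s, Φ (s, (Fin.snoc (historyAt t ω) (actionAt t ω, o) : Fin (t + 1) → A × O))
        ∂(u.τ (M.belief u t (historyAt t ω), actionAt t ω, o) : Measure S)
        ∂M.predictive (M.belief u t (historyAt t ω), actionAt t ω) ∂M.trajLaw π := by
  have hsn : Measurable fun p : (Fin t → A × O) × A × O ↦
      (Fin.snoc p.1 p.2 : Fin (t + 1) → A × O) := measurable_finSnoc t
  have hb := M.measurable_belief u t
  have hF : Measurable fun p : (Fin t → A × O) × (S × A × S × O) ↦
      Φ (p.2.2.2.1, (Fin.snoc p.1 (p.2.2.1, p.2.2.2.2) : Fin (t + 1) → A × O)) :=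
    hΦ.comp (.prodMk (by fun_prop) (hsn.comp
      (.prodMk measurable_fst (.prodMk (by fun_prop) (by fun_prop)))))
  have hg : ∀ h a, Measurable fun q : S × O ↦
      Φ (q.1, (Fin.snoc h (a, q.2) : Fin (t + 1) → A × O)) := fun h a ↦
    hΦ.comp (.prodMk (by fun_prop) (hsn.comp
      (.prodMk measurable_const (.prodMk measurable_const measurable_snd))))
  have hm : Measurable fun p : (Fin t → A × O) × A ↦
      ∫⁻ q, Φ (q.1, (Fin.snoc p.1 (p.2, q.2) : Fin (t + 1) → A × O))
        ∂M.jointKernel (M.belief u t p.1, p.2) :=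
    Measurable.lintegral_kernel_prod_right'
      (κ := M.jointKernel.comap (fun p : (Fin t → A × O) × A ↦ (M.belief u t p.1, p.2))
        (by fun_prop))
      (f := fun p ↦ Φ (p.2.1, (Fin.snoc p.1.1 (p.1.2, p.2.2) : Fin (t + 1) → A × O)))
      (hΦ.comp (.prodMk (by fun_prop) (hsn.comp
        (.prodMk (by fun_prop) (.prodMk (by fun_prop) (by fun_prop))))))
  simp_rw [historyAt_succ]
  refine (H.lintegral_eq hF).trans ?_
  have h1 : ∀ h a, ∫⁻ s, ∫⁻ q, Φ (q.1, (Fin.snoc h (a, q.2) : Fin (t + 1) → A × O))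
      ∂M.envKernel (s, a) ∂M.historyBelief u t h =
      ∫⁻ q, Φ (q.1, (Fin.snoc h (a, q.2) : Fin (t + 1) → A × O))
        ∂M.jointKernel (M.belief u t h, a) := fun h a ↦
    M.lintegral_lintegral_envKernel (M.belief u t h) a (hg h a)
  simp_rw [h1]
  -- With `s`, `s'` and `o` integrated out, the integrand depends only on the history and the
  -- action, so the integral over the policy can be replaced by evaluation at the realized `a_t`.
  rw [← H.lintegral_action hm]
  refine lintegral_congr fun ω ↦ ?_
  exact M.lintegral_jointKernel u _ (hg _ _)

/-- Both sides are expanded by `lintegral_next`. On the right the integrand no longer depends on the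
state, so the integral against the posterior is trivial, and `belief_snoc` identifies that posterior
with the updated belief. -/
theorem IsFilterAt.lintegral_next_eq_belief {t : ℕ} (H : M.IsFilterAt u π t)
    {Φ : S × (Fin (t + 1) → A × O) → ENNReal} (hΦ : Measurable Φ) :
    ∫⁻ ω, Φ ((ω t).2.2.1, historyAt (t + 1) ω) ∂M.trajLaw π =
      ∫⁻ ω, ∫⁻ s, Φ (s, historyAt (t + 1) ω) ∂M.historyBelief u (t + 1) (historyAt (t + 1) ω)
        ∂M.trajLaw π := by
  have hm : Measurable fun h ↦ ∫⁻ s, Φ (s, h) ∂M.historyBelief u (t + 1) h :=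
    Measurable.lintegral_kernel_prod_right' (f := fun p ↦ Φ (p.2, p.1))
      (hΦ.comp measurable_swap)
  rw [H.lintegral_next hΦ, H.lintegral_next (Φ := fun p ↦ ∫⁻ s, Φ (s, p.2)
    ∂M.historyBelief u (t + 1) p.2) (hm.comp measurable_snd)]
  simp only [historyBelief, Kernel.comap_apply, belief_snoc, lintegral_const, measure_univ, mul_one]
  rfl

variable (M u π)

theorem isFilterAt (t : ℕ) : M.IsFilterAt u π t := by
  induction t with
  | zero =>
    intro F hF
    -- There is only one empty history, and its belief is `ν₀`, so the claim reduces to the initial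
    -- law.
    have h0 : ∀ ω : ℕ → S × A × S × O, historyAt 0 ω = Fin.elim0 := fun ω ↦ Subsingleton.elim _ _
    have hm : Measurable fun y ↦ F (Fin.elim0, y) := hF.comp measurable_prodMk_left
    simp_rw [h0]
    rw [lintegral_const, measure_univ, mul_one]
    have hl := map_eval_zero_trajMeasure (X := fun _ ↦ S × A × S × O)
      (((M.ν₀ : Measure S).map fun s ↦ (s, (Fin.elim0 : Fin 0 → A × O))).bind (M.transition π 0))
      (M.stepKernel π)
    rw [← trajLaw] at hl
    rw [← lintegral_map (μ := M.trajLaw π) (g := fun ω ↦ ω 0) hm (by fun_prop), hl,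
      Measure.lintegral_bind (Kernel.aemeasurable _) hm.aemeasurable,
      lintegral_map hm.lintegral_kernel (by fun_prop)]
    rfl
  | succ t ih =>
    intro F hF
    refine (lintegral_trajMeasure_succ (X := fun _ ↦ S × A × S × O) _ (M.stepKernel π) t
      (f := fun p ↦ F (fun i ↦ ((p.1 ⟨i, Finset.mem_Iic.2 (Nat.lt_succ_iff.1 i.2)⟩).2.1,
        (p.1 ⟨i, Finset.mem_Iic.2 (Nat.lt_succ_iff.1 i.2)⟩).2.2.2), p.2))
      (hF.comp (by fun_prop))).trans ?_
    -- The next step starts from `s_{t+1}`, stored in coordinate `t`, and from `h_{t+1}`.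
    -- Integrating out coordinate `t + 1` thus leaves a function of these two alone.
    have hΦ : Measurable fun p : S × (Fin (t + 1) → A × O) ↦
        ∫⁻ y, F (p.2, y) ∂M.transition π (t + 1) p :=
      Measurable.lintegral_kernel_prod_right' (f := fun q : (S × (Fin (t + 1) → A × O)) × _ ↦
        F (q.1.2, q.2)) (hF.comp (by fun_prop))
    exact ih.lintegral_next_eq_belief hΦ

/-- The belief is a version of the conditional law of the current state given the history. -/
theorem trajLaw_state_history (t : ℕ) {U : Set S} {H : Set (Fin t → A × O)}
    (hU : MeasurableSet U) (hH : MeasurableSet H) :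
    M.trajLaw π {ω | stateAt t ω ∈ U ∧ historyAt t ω ∈ H} =
      ∫⁻ h in H, (M.belief u t h : Measure S) U ∂(M.trajLaw π).map (historyAt t) := by
  have hs := measurable_stateAt (S := S) (A := A) (O := O) t
  have hh := measurable_historyAt (S := S) (A := A) (O := O) t
  have hb : Measurable fun h ↦ (M.belief u t h : Measure S) U :=
    (M.historyBelief u t).measurable_coe hU
  have h1 := (M.isFilterAt u π t).lintegral_state_action
    (f := fun p ↦ H.indicator (fun _ ↦ 1) p.1.1 * U.indicator (fun _ ↦ 1) p.2)
    (((measurable_const.indicator hH).comp (by fun_prop)).mul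
      ((measurable_const.indicator hU).comp measurable_snd))
  have hset : {ω : ℕ → S × A × S × O | stateAt t ω ∈ U ∧ historyAt t ω ∈ H} =
      stateAt t ⁻¹' U ∩ historyAt t ⁻¹' H := rfl
  rw [hset, ← lintegral_indicator_one ((hs hU).inter (hh hH)), ← lintegral_indicator hH,
    lintegral_map (hb.indicator hH) hh]
  refine Eq.trans (lintegral_congr fun ω ↦ ?_) (h1.trans (lintegral_congr fun ω ↦ ?_))
  · by_cases h1 : historyAt t ω ∈ H <;> by_cases h2 : stateAt t ω ∈ U <;> simp [h1, h2]
  · dsimp only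
    rw [lintegral_const_mul _ (measurable_const.indicator hU), lintegral_indicator_const hU,
      one_mul]
    by_cases hω : historyAt t ω ∈ H
    · simp only [hω, Set.indicator_of_mem, one_mul]
      rfl
    · simp [hω]

/-! ### Laws of belief-action pairs and the transfer of returns -/

/-- The law of `(b_t, a_t)`. -/
noncomputable def beliefActionLaw (t : ℕ) : Measure (ProbabilityMeasure S × A) :=
  (M.trajLaw π).map fun ω ↦ (M.belief u t (historyAt t ω), actionAt t ω)

theorem measurable_belief_action (t : ℕ) :
    Measurable fun ω : ℕ → S × A × S × O ↦ (M.belief u t (historyAt t ω), actionAt t ω) :=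
  ((M.measurable_belief u t).comp (measurable_historyAt t)).prodMk (measurable_actionAt t)

instance (t : ℕ) : IsProbabilityMeasure (M.beliefActionLaw u π t) :=
  Measure.isProbabilityMeasure_map (M.measurable_belief_action u t).aemeasurable

theorem lintegral_beliefActionLaw (t : ℕ) {f : ProbabilityMeasure S × A → ENNReal}
    (hf : Measurable f) :
    ∫⁻ p, f p ∂M.beliefActionLaw u π t =
      ∫⁻ ω, ∫⁻ a, f (M.belief u t (historyAt t ω), a) ∂π.kernel t (historyAt t ω)
        ∂M.trajLaw π := by
  have hb := M.measurable_belief u t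
  rw [beliefActionLaw, lintegral_map hf (M.measurable_belief_action u t)]
  exact (M.isFilterAt u π t).lintegral_action (f := fun p ↦ f (M.belief u t p.1, p.2))
    (hf.comp (by fun_prop))

theorem fst_beliefActionLaw (t : ℕ) :
    (M.beliefActionLaw u π t).fst =
      (M.trajLaw π).map fun ω ↦ M.belief u t (historyAt t ω) := by
  rw [Measure.fst, beliefActionLaw, Measure.map_map measurable_fst (M.measurable_belief_action u t)]
  rfl

/-- The belief moves according to the belief transition kernel. -/
theorem fst_beliefActionLaw_succ (t : ℕ) :
    (M.beliefActionLaw u π (t + 1)).fst =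
      (M.beliefActionLaw u π t).bind (M.beliefTransition u) := by
  refine Measure.ext_of_lintegral _ fun f hf ↦ ?_
  have hb := M.measurable_belief u (t + 1)
  have hh := measurable_historyAt (S := S) (A := A) (O := O) (t + 1)
  rw [fst_beliefActionLaw, lintegral_map hf (by fun_prop),
    Measure.lintegral_bind (Kernel.aemeasurable _) hf.aemeasurable, beliefActionLaw,
    lintegral_map hf.lintegral_kernel (M.measurable_belief_action u t)]
  -- The test function ignores the next state, so only the predictive law of `o`, pushed forward by
  -- `τ`, survives; this is `P_B`.
  refine ((M.isFilterAt u π t).lintegral_next (Φ := fun p ↦ f (M.belief u (t + 1) p.2))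
    (hf.comp (by fun_prop))).trans (lintegral_congr fun ω ↦ ?_)
  rw [beliefTransition, Kernel.lintegral_map _ u.measurable_uncurried _ hf,
    Kernel.lintegral_id_prod
      (f := fun p : (ProbabilityMeasure S × A) × O ↦ f (u.τ (p.1.1, p.1.2, p.2)))
      (hf.comp u.measurable_uncurried)]
  simp [belief_snoc]

variable {M u π} in
/-- If a belief policy disintegrates the laws of `(b_t, a_t)`, then the belief process it generates
has these marginals. -/
theorem beliefActionLaw_eq_marginal {πB : NonstationaryPolicy (ProbabilityMeasure S) A}
    (h : ∀ t, (M.beliefActionLaw u π t).fst ⊗ₘ πB.kernel t = M.beliefActionLaw u π t) (t : ℕ) :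
    M.beliefActionLaw u π t = (M.beliefMDP u).marginal πB t M.ν₀ := by
  induction t with
  | zero =>
    -- The initial belief is the constant `ν₀`, so its law is a Dirac mass.
    rw [← h 0, fst_beliefActionLaw]
    simp only [belief]
    rw [Measure.map_const, measure_univ, one_smul, DiscountedMDP.marginal,
      Measure.compProd_eq_comp_prod, Measure.dirac_bind (Kernel.measurable _)]
  | succ t ih =>
    rw [← h (t + 1), fst_beliefActionLaw_succ, ih, Measure.compProd_eq_comp_prod,
      DiscountedMDP.marginal, Kernel.comp_apply, Kernel.comp_apply]
    rfl

/-- Given `(b_t, a_t)`, the state `s_t` has law `b_t`; integrating it out of `r(s_t, a_t)` gives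
`r_B(b_t, a_t)`. -/
theorem integral_reward (t : ℕ) :
    ∫ ω, M.r (stateAt t ω, actionAt t ω) ∂M.trajLaw π =
      ∫ p, M.beliefReward p ∂M.beliefActionLaw u π t := by
  have hs := measurable_stateAt (S := S) (A := A) (O := O) t
  have hba := M.measurable_belief_action u t
  have hb := M.measurable_belief u t
  have hlaw : (M.trajLaw π).map (fun ω ↦
      ((M.belief u t (historyAt t ω), actionAt t ω), stateAt t ω)) =
      M.beliefActionLaw u π t ⊗ₘ (beliefKernel S).comap Prod.fst measurable_fst := by
    refine Measure.ext_of_lintegral _ fun f hf ↦ ?_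
    rw [lintegral_map hf (hba.prodMk hs), Measure.lintegral_compProd hf, beliefActionLaw,
      lintegral_map (hf.lintegral_kernel_prod_right') hba]
    exact (M.isFilterAt u π t).lintegral_state_action
      (f := fun p ↦ f ((M.belief u t p.1.1, p.1.2), p.2)) (hf.comp (by fun_prop))
  obtain ⟨R, hR⟩ := M.bounded_r
  have hr : Measurable fun q : (ProbabilityMeasure S × A) × S ↦ M.r (q.2, q.1.2) :=
    M.measurable_r.comp (by fun_prop)
  have hi := integral_map (μ := M.trajLaw π) (hba.prodMk hs).aemeasurable
    hr.aestronglyMeasurable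
  rw [hlaw, Measure.integral_compProd (.of_bound hr.aestronglyMeasurable R
    (.of_forall fun _ ↦ hR _))] at hi
  exact hi.symm

variable {M u π} in
theorem value_eq_of_disintegrates {πB : NonstationaryPolicy (ProbabilityMeasure S) A}
    (h : ∀ t, (M.beliefActionLaw u π t).fst ⊗ₘ πB.kernel t = M.beliefActionLaw u π t) :
    M.value π = (M.beliefMDP u).value πB M.ν₀ := by
  obtain ⟨R, hR⟩ := M.bounded_r
  rw [value, integral_tsum_discounted (M.trajLaw π) M.γ_pos M.γ_lt_one
    (f := fun t ω ↦ M.r (stateAt t ω, actionAt t ω))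
    (fun t ↦ M.measurable_r.comp ((measurable_stateAt t).prodMk (measurable_actionAt t)))
    fun _ _ ↦ hR _, DiscountedMDP.value_eq_tsum]
  refine tsum_congr fun t ↦ ?_
  rw [M.integral_reward u π t, beliefActionLaw_eq_marginal h]
  rfl

/-! ### Matching policies in both directions -/

/-- The belief policy that plays `a_t` with its conditional law given `b_t` under `π`. -/
noncomputable def conditionalBeliefPolicy [StandardBorelSpace A] [Nonempty A] :
    NonstationaryPolicy (ProbabilityMeasure S) A where
  kernel t := (M.beliefActionLaw u π t).condKernel
  markov _ := inferInstance

/-- The history-dependent policy that feeds the current belief to a belief policy. -/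
noncomputable def feedbackPolicy (πB : NonstationaryPolicy (ProbabilityMeasure S) A) :
    HistoryPolicy A O where
  kernel t := (πB.kernel t).comap (M.belief u t) (M.measurable_belief u t)
  markov _ := inferInstance

/-- The action law given `h_t` depends on `h_t` only through `b_t`, so it is also the conditional
law given `b_t`. -/
theorem feedbackPolicy_disintegrates (πB : NonstationaryPolicy (ProbabilityMeasure S) A) (t : ℕ) :
    (M.beliefActionLaw u (M.feedbackPolicy u πB) t).fst ⊗ₘ πB.kernel t =
      M.beliefActionLaw u (M.feedbackPolicy u πB) t := by
  refine Measure.ext_of_lintegral _ fun f hf ↦ ?_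
  have hb := M.measurable_belief u t
  have hh := measurable_historyAt (S := S) (A := A) (O := O) t
  rw [Measure.lintegral_compProd hf, fst_beliefActionLaw,
    lintegral_map hf.lintegral_kernel_prod_right' (by fun_prop),
    lintegral_beliefActionLaw _ _ _ _ hf]
  rfl

theorem exists_beliefPolicy [StandardBorelSpace A] :
    ∃ πB : NonstationaryPolicy (ProbabilityMeasure S) A,
      ∀ t, (M.beliefActionLaw u π t).fst ⊗ₘ πB.kernel t = M.beliefActionLaw u π t := by
  -- Conditional kernels require a nonempty action space; it is nonempty because it carries the
  -- probability measure given by `π`.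
  have := (π.kernel 0 Fin.elim0).nonempty_of_neZero
  exact ⟨M.conditionalBeliefPolicy u π, fun t ↦
    (M.beliefActionLaw u π t).disintegrate (M.beliefActionLaw u π t).condKernel⟩

end DiscountedPOMDP

theorem mainTheorem8 {S A O : Type*} [MeasurableSpace S] [StandardBorelSpace S]
    [MeasurableSpace A] [StandardBorelSpace A] [MeasurableSpace O] [StandardBorelSpace O]
    (M : DiscountedPOMDP S A O) (u : M.BayesUpdate) :
    -- the belief is a measurable function of the history, and under every policy it is a
    -- version of the conditional law of the current state given the history
    (∀ t, Measurable (M.belief u t)) ∧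
    (∀ (π : HistoryPolicy A O) (t : ℕ) (U : Set S) (H : Set (Fin t → A × O)),
      MeasurableSet U → MeasurableSet H →
        M.trajLaw π {ω | DiscountedPOMDP.stateAt t ω ∈ U ∧ DiscountedPOMDP.historyAt t ω ∈ H} =
          ∫⁻ h in H, (M.belief u t h : Measure S) U
            ∂(M.trajLaw π).map (DiscountedPOMDP.historyAt t)) ∧
    -- every history-dependent policy is matched by a belief policy
    (∀ π : HistoryPolicy A O, ∃ πB : NonstationaryPolicy (ProbabilityMeasure S) A,
      (∀ t, (M.trajLaw π).map (fun ω ↦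
          (M.belief u t (DiscountedPOMDP.historyAt t ω), DiscountedPOMDP.actionAt t ω)) =
        ((M.beliefMDP u).trajLaw πB M.ν₀).map (fun ω ↦ ω t)) ∧
      M.value π = (M.beliefMDP u).value πB M.ν₀) ∧
    -- every belief policy is implemented by the history-dependent policy that feeds it the belief
    (∀ πB : NonstationaryPolicy (ProbabilityMeasure S) A, ∃ π : HistoryPolicy A O,
      (∀ t h, π.kernel t h = πB.kernel t (M.belief u t h)) ∧
      (∀ t, (M.trajLaw π).map (fun ω ↦
          (M.belief u t (DiscountedPOMDP.historyAt t ω), DiscountedPOMDP.actionAt t ω)) =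
        ((M.beliefMDP u).trajLaw πB M.ν₀).map (fun ω ↦ ω t)) ∧
      M.value π = (M.beliefMDP u).value πB M.ν₀) ∧
    -- the optimal values are suprema of bounded sets, and agree
    BddAbove (Set.range fun π : HistoryPolicy A O ↦ M.value π) ∧
    BddAbove (Set.range fun πB : NonstationaryPolicy (ProbabilityMeasure S) A ↦
      (M.beliefMDP u).value πB M.ν₀) ∧
    M.optimalValue = (M.beliefMDP u).optimalValue M.ν₀ ∧
    -- stationary belief policies: the Bellman backup is a contraction on the bounded measurable
    -- functions, and the return is its unique fixed point and the limit of value iteration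
    (∀ (κ : Kernel (ProbabilityMeasure S) A) [IsMarkovKernel κ],
      (∀ V, IsBoundedMeasurable V → IsBoundedMeasurable ((M.beliefMDP u).bellman κ V)) ∧
      (∀ V W, IsBoundedMeasurable V → IsBoundedMeasurable W →
        supNorm ((M.beliefMDP u).bellman κ V - (M.beliefMDP u).bellman κ W) ≤
          M.γ * supNorm (V - W)) ∧
      IsBoundedMeasurable ((M.beliefMDP u).value (.stationary κ)) ∧
      (∀ V, IsBoundedMeasurable V →
        ((M.beliefMDP u).bellman κ V = V ↔ V = (M.beliefMDP u).value (.stationary κ))) ∧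
      (∀ V, IsBoundedMeasurable V → ∀ k : ℕ,
        supNorm (((M.beliefMDP u).bellman κ)^[k] V - (M.beliefMDP u).value (.stationary κ)) ≤
          M.γ ^ k * supNorm (V - (M.beliefMDP u).value (.stationary κ)))) := by
  have hmatch : ∀ (π : HistoryPolicy A O) (πB : NonstationaryPolicy (ProbabilityMeasure S) A),
      (∀ t, (M.beliefActionLaw u π t).fst ⊗ₘ πB.kernel t = M.beliefActionLaw u π t) →
      (∀ t, (M.trajLaw π).map (fun ω ↦
          (M.belief u t (DiscountedPOMDP.historyAt t ω), DiscountedPOMDP.actionAt t ω)) =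
        ((M.beliefMDP u).trajLaw πB M.ν₀).map (fun ω ↦ ω t)) ∧
      M.value π = (M.beliefMDP u).value πB M.ν₀ := fun π πB h ↦
    ⟨fun t ↦ (DiscountedPOMDP.beliefActionLaw_eq_marginal h t).trans
      ((M.beliefMDP u).map_eval_trajLaw πB M.ν₀ t).symm,
      DiscountedPOMDP.value_eq_of_disintegrates h⟩
  have hto : ∀ π : HistoryPolicy A O, ∃ πB : NonstationaryPolicy (ProbabilityMeasure S) A,
      (∀ t, (M.trajLaw π).map (fun ω ↦
          (M.belief u t (DiscountedPOMDP.historyAt t ω), DiscountedPOMDP.actionAt t ω)) =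
        ((M.beliefMDP u).trajLaw πB M.ν₀).map (fun ω ↦ ω t)) ∧
      M.value π = (M.beliefMDP u).value πB M.ν₀ := fun π ↦
    (M.exists_beliefPolicy u π).imp fun πB h ↦ hmatch π πB h
  have hfrom := fun πB ↦ hmatch _ πB (M.feedbackPolicy_disintegrates u πB)
  obtain ⟨R, hR⟩ := M.bounded_r
  refine ⟨M.measurable_belief u, fun π t U H hU hH ↦ M.trajLaw_state_history u π t hU hH, hto,
    fun πB ↦ ⟨M.feedbackPolicy u πB, fun _ _ ↦ rfl, hfrom πB⟩, ?_, ?_, ?_, fun κ _ ↦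
    ⟨fun V ↦ (M.beliefMDP u).isBoundedMeasurable_bellman κ,
      fun V W ↦ (M.beliefMDP u).supNorm_bellman_sub_le κ,
      (M.beliefMDP u).isBoundedMeasurable_value _,
      fun V ↦ (M.beliefMDP u).bellman_eq_self_iff κ,
      fun V ↦ (M.beliefMDP u).supNorm_iterate_bellman_sub_value_le κ⟩⟩
  · exact ⟨(1 - M.γ)⁻¹ * R, Set.forall_mem_range.2 fun π ↦ (le_abs_self _).trans
      (abs_integral_tsum_discounted_le _ M.γ_pos M.γ_lt_one fun _ _ ↦ hR _)⟩
  · exact ⟨(1 - M.γ)⁻¹ * R, Set.forall_mem_range.2 fun πB ↦ (le_abs_self _).trans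
      ((M.beliefMDP u).abs_value_le (M.abs_beliefReward_le hR) πB M.ν₀)⟩
  -- The two sets of attained returns are equal, hence so are their suprema.
  · refine congrArg sSup (Set.Subset.antisymm ?_ ?_)
    · rintro _ ⟨π, rfl⟩
      obtain ⟨πB, -, h⟩ := hto π
      exact ⟨πB, h.symm⟩
    · rintro _ ⟨πB, rfl⟩
      exact ⟨M.feedbackPolicy u πB, (hfrom πB).2⟩
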